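/- Let $n \ge 3$. A finite simple graph is planar if it can be embedded in the plane so that its edges meet only at common endpoints, and maximal planar if it is planar and no edge can be added on the same vertex set without destroying planarity. Then the maximum number of $4$-cliques (sets of four pairwise adjacent vertices) in a maximal planar graph with $n$ vertices is $n-3$; that is, every maximal planar graph with $n$ vertices has at most $n-3$ $4$-cliques, and for every $n \ge 3$ some maximal planar graph with $n$ vertices has exactly $n-3$ of them. -/

import Mathlib

namespace SimpleGraph

/-- A drawing of a graph in the Euclidean plane in which edges meet only at common endpoints:
distinct vertices are distinct points, every edge is a simple (injective, continuous) arc between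
the points of its two endpoints, an arc passes through no other vertex, and two distinct edges
share at most the points of common endpoints. The value of `arc` is irrelevant on pairs that are
not edges. -/
structure PlaneEmbedding {V : Type*} (G : SimpleGraph V) where
  /-- the point that represents a vertex -/
  point : V → EuclideanSpace ℝ (Fin 2)
  /-- the set of points on the curve that represents an edge -/
  arc : Sym2 V → Set (EuclideanSpace ℝ (Fin 2))
  point_injective : Function.Injective point
  arc_isArc : ∀ u v : V, G.Adj u v →
    ∃ γ : _root_.Path (point u) (point v), Function.Injective γ ∧ Set.range γ = arc s(u, v)
  point_mem_arc : ∀ e ∈ G.edgeSet, ∀ w : V, point w ∈ arc e → w ∈ e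
  arc_inter_arc : ∀ e ∈ G.edgeSet, ∀ f ∈ G.edgeSet, e ≠ f →
    ∀ x ∈ arc e ∩ arc f, ∃ w : V, w ∈ e ∧ w ∈ f ∧ x = point w

/-- A graph is planar if it can be embedded in the plane. -/
def IsPlanar {V : Type*} (G : SimpleGraph V) : Prop :=
  Nonempty G.PlaneEmbedding

/-- A planar graph is maximal planar if no edge can be added, on the same vertex set, without
destroying planarity. -/
def IsMaximalPlanar {V : Type*} (G : SimpleGraph V) : Prop :=
  Maximal (fun H : SimpleGraph V => H.IsPlanar) G

/-- The number of cliques with exactly `m` vertices (meant for finite graphs). -/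
noncomputable def numCliques {V : Type*} (G : SimpleGraph V) (m : ℕ) : ℕ :=
  {s : Finset V | G.IsNClique m s}.ncard

end SimpleGraph

/-!
Only planarity matters for the upper bound. Let `T` be a 4-clique of a planar graph on a vertex set
`S` and let `C` be a connected component of `S \ T`. If all four vertices of `T` had a neighbour in
`C`, then `C` and the vertices of `T` would be the branch sets of a `K₅` minor. So `C` misses some
`t ∈ T`, and the triangle `T \ {t}` separates `C` from the rest. Every 4-clique lies in
`C ∪ (T \ {t})` or in `S \ C`, two smaller sets whose cardinalities add up to `S.card + 3`, and
`(a - 3) + (b - 3) = (a + b - 3) - 3` makes the induction work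
(`SimpleGraph.IsPlanar.card_cliques_four_le`).

That a planar graph has no `K₅` minor (`SimpleGraph.IsPlanar.not_five_branch_sets`) is deduced for
arbitrary continuous arcs without the Jordan curve theorem. Five points of the plane cannot be
joined pairwise by curves such that curves without a common end are disjoint
(`not_disjoint_curves_of_five_points`). Indeed, for disjoint curves `γ` and `δ` the difference
`γ s - δ t` has a continuous logarithm on the square, so its increments along the four sides add up
to zero. The increment of the logarithm of `γ - v`, where `v` is one of the five points not on `γ`,
is determined by the end points up to a winding number. In the sum over the 15 pairs of disjoint
edges of `K₅` every winding number occurs twice, but the remaining terms contribute an odd number,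
the number of crossings of a convex drawing of `K₅`. The curves need be neither simple nor disjoint
from curves with which they share an end, so they may run freely through the branch sets of a minor
and no contraction of edges is needed.

For the lower bound, the join of an edge with a path on `n - 2` vertices has a straight-line drawing
and contains `n - 3` 4-cliques. Some maximal planar graph contains it, and has no more than `n - 3`
by the upper bound.
-/

/-! ### Logarithms along curves and the non-planarity of `K₅` -/

open Complex in
/-- A nowhere vanishing continuous function on a simply connected, locally path connected space
has a continuous logarithm. -/
theorem exists_continuous_exp_eq {A : Type*} [TopologicalSpace A] [SimplyConnectedSpace A]
    [LocallyPathConnectedSpace A] {g : A → ℂ} (hg : Continuous g) (h0 : ∀ a, g a ≠ 0) :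
    ∃ L : A → ℂ, Continuous L ∧ ∀ a, exp (L a) = g a := by
  obtain ⟨a₀⟩ : Nonempty A := inferInstance
  obtain ⟨f, ⟨-, hf⟩, -⟩ := isCoveringMapOn_exp.existsUnique_continuousMap_lifts
    ⟨g, hg⟩ (exp_log (h0 a₀)) h0
  exact ⟨f, f.continuous, fun a => congrFun hf a⟩

open Complex in
/-- Two continuous logarithms of the same function on the line differ by a constant. -/
theorem sub_eq_sub_of_exp_eq_exp {L M : ℝ → ℂ} (hL : Continuous L) (hM : Continuous M)
    (h : ∀ t, exp (L t) = exp (M t)) (s t : ℝ) : L t - L s = M t - M s := by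
  have h1 : ∀ a, exp (L a) = exp (M a + (L s - M s)) := fun a => by
    rw [exp_add, exp_sub, h s, h a, div_self (exp_ne_zero _), mul_one]
  have h2 : L = fun a => M a + (L s - M s) := by
    refine isCoveringMap_exp.eq_of_comp_eq hL (by fun_prop) ?_ s (by ring)
    funext a
    exact Subtype.ext (h1 a)
  have := congrFun h2 t
  rw [this]; ring

open Complex Classical in
/-- The increment over `[0, 1]` of a continuous logarithm of `g : ℝ → ℂ`; its imaginary part is
the total variation of the argument along the curve `g`. The value is `0` if `g` has no continuous
logarithm. -/
noncomputable def logIncrement (g : ℝ → ℂ) : ℂ :=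
  if h : ∃ L : ℝ → ℂ, Continuous L ∧ ∀ t, exp (L t) = g t then h.choose 1 - h.choose 0 else 0

open Complex in
theorem logIncrement_eq {g L : ℝ → ℂ} (hL : Continuous L) (h : ∀ t, exp (L t) = g t) :
    logIncrement g = L 1 - L 0 := by
  have hex : ∃ L : ℝ → ℂ, Continuous L ∧ ∀ t, exp (L t) = g t := ⟨L, hL, h⟩
  rw [logIncrement, dif_pos hex]
  exact sub_eq_sub_of_exp_eq_exp hex.choose_spec.1 hL
    (fun t => by rw [hex.choose_spec.2, h]) 0 1

open Complex in
/-- The increment of the logarithm is determined by the end points up to a winding number. -/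
theorem exists_int_logIncrement_eq {g : ℝ → ℂ} (hg : Continuous g) (h0 : ∀ t, g t ≠ 0) {u w : ℂ}
    (hu : exp u = g 0) (hw : exp w = g 1) :
    ∃ k : ℤ, logIncrement g = w - u + k * (2 * Real.pi * I) := by
  obtain ⟨L, hL, h⟩ := exists_continuous_exp_eq hg h0
  rw [logIncrement_eq hL h]
  obtain ⟨m, hm⟩ := exp_eq_exp_iff_exists_int.1 ((h 0).trans hu.symm)
  obtain ⟨n, hn⟩ := exp_eq_exp_iff_exists_int.1 ((h 1).trans hw.symm)
  refine ⟨n - m, ?_⟩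
  rw [hm, hn]
  push_cast
  ring

open Complex in
/-- For two disjoint curves `γ` and `δ`, the function `γ s - δ t` has a continuous logarithm on the
square, so that its increments along the four sides add up to zero. On two of the sides the
difference is reversed, which does not change the increment. -/
theorem logIncrement_add_logIncrement_of_disjoint {γ δ : ℝ → ℂ} (hγ : Continuous γ)
    (hδ : Continuous δ) (h : ∀ s t, γ s ≠ δ t) :
    logIncrement (fun s => γ s - δ 0) + logIncrement (fun t => δ t - γ 1) =
      logIncrement (fun s => γ s - δ 1) + logIncrement (fun t => δ t - γ 0) := by
  obtain ⟨L, hL, hexp⟩ := exists_continuous_exp_eq (A := ℝ × ℝ) (g := fun x => γ x.1 - δ x.2)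
    (by fun_prop) (fun x => sub_ne_zero.2 (h _ _))
  have horiz : ∀ t, logIncrement (fun s => γ s - δ t) = L (1, t) - L (0, t) := fun t =>
    logIncrement_eq (L := fun s => L (s, t)) (by fun_prop) fun s => hexp (s, t)
  have vert : ∀ s, logIncrement (fun t => δ t - γ s) = L (s, 1) - L (s, 0) := fun s => by
    rw [logIncrement_eq (L := fun t => L (s, t) + Real.pi * I) (by fun_prop) fun t => by
      rw [exp_add, exp_pi_mul_I, hexp]; simp]
    ring
  rw [horiz, horiz, vert, vert]
  ring

open Complex in
/-- Five points of the plane cannot be joined pairwise by curves in such a way that any two curves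
without a common end are disjoint. -/
theorem not_disjoint_curves_of_five_points (p : Fin 5 → ℂ) (γ : Fin 5 → Fin 5 → ℝ → ℂ)
    (hγ : ∀ i j, i ≠ j → Continuous (γ i j)) (h0 : ∀ i j, i ≠ j → γ i j 0 = p i)
    (h1 : ∀ i j, i ≠ j → γ i j 1 = p j)
    (hdisj : ∀ a b c d, a ≠ b → c ≠ d → a ≠ c → a ≠ d → b ≠ c → b ≠ d →
      ∀ s t, γ a b s ≠ γ c d t) : False := by
  have third : ∀ v c d : Fin 5, ∃ w, w ≠ v ∧ w ≠ c ∧ w ≠ d := by decide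
  have hpt : ∀ v c d, v ≠ c → v ≠ d → c ≠ d → ∀ t, γ c d t - p v ≠ 0 := by
    intro v c d hvc hvd hcd t
    obtain ⟨w, hwv, hwc, hwd⟩ := third v c d
    rw [sub_ne_zero, ← h0 v w hwv.symm]
    exact (hdisj v w c d hwv.symm hcd hvc hvd hwc hwd 0 t).symm
  have hp : ∀ u v, u ≠ v → p v - p u ≠ 0 := by
    intro u v huv
    obtain ⟨w, hwu, hwv, -⟩ := third u v v
    rw [← h0 v w hwv.symm]
    exact hpt u v w huv hwu.symm hwv.symm 0
  let ε : Fin 5 → Fin 5 → ℤ := fun u v => if u < v then -1 else 1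
  -- Choose logarithms of all the differences, for the two orders of a pair half a turn apart.
  obtain ⟨α, hα, hαε⟩ : ∃ α : Fin 5 → Fin 5 → ℂ, (∀ u v, u ≠ v → exp (α u v) = p v - p u) ∧
      ∀ u v, u ≠ v → α u v - α v u = ε u v * (Real.pi * I) := by
    refine ⟨fun u v => if u < v then log (p v - p u) else log (p u - p v) + Real.pi * I, ?_, ?_⟩
    · intro u v huv
      dsimp only
      split_ifs
      · exact exp_log (hp u v huv)
      · rw [exp_add, exp_pi_mul_I, exp_log (hp v u huv.symm)]; ring
    · intro u v huv
      rcases lt_or_gt_of_ne huv with h | h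
      · simp [ε, h, h.not_gt]
      · simp [ε, h, h.not_gt]
  have hk : ∀ v c d, ∃ k : ℤ, v ≠ c → v ≠ d → c ≠ d →
      logIncrement (fun t => γ c d t - p v) = α v d - α v c + k * (2 * Real.pi * I) := by
    intro v c d
    by_cases h : v ≠ c ∧ v ≠ d ∧ c ≠ d
    · obtain ⟨hvc, hvd, hcd⟩ := h
      have := hγ c d hcd
      obtain ⟨k, hk⟩ := exists_int_logIncrement_eq (g := fun t => γ c d t - p v) (by fun_prop)
        (hpt v c d hvc hvd hcd) (u := α v c) (w := α v d)
        (by rw [hα v c hvc, h0 c d hcd]) (by rw [hα v d hvd, h1 c d hcd])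
      exact ⟨k, fun _ _ _ => hk⟩
    · exact ⟨0, fun h1 h2 h3 => absurd ⟨h1, h2, h3⟩ h⟩
  choose k hk using hk
  have key : ∀ a b c d, a ≠ b → c ≠ d → a ≠ c → a ≠ d → b ≠ c → b ≠ d →
      ε c b + ε a c + ε b d + ε d a + 2 * (k c a b + k b c d - k d a b - k a c d) = 0 := by
    intro a b c d hab hcd hac had hbc hbd
    have h := logIncrement_add_logIncrement_of_disjoint (hγ a b hab) (hγ c d hcd)
      (hdisj a b c d hab hcd hac had hbc hbd)
    rw [h0 c d hcd, h1 c d hcd, h0 a b hab, h1 a b hab, hk c a b hac.symm hbc.symm hab,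
      hk b c d hbc hbd hcd, hk d a b had.symm hbd.symm hab, hk a c d hac had hcd] at h
    have h' : ((ε c b + ε a c + ε b d + ε d a +
        2 * (k c a b + k b c d - k d a b - k a c d) : ℤ) : ℂ) * (Real.pi * I) = 0 := by
      push_cast
      linear_combination h - hαε c b hbc.symm - hαε a c hac - hαε b d hbd - hαε d a had.symm
    have hpi : (Real.pi * I : ℂ) ≠ 0 :=
      mul_ne_zero (ofReal_ne_zero.2 Real.pi_ne_zero) I_ne_zero
    exact_mod_cast (mul_eq_zero.1 h').resolve_right hpi
  -- Add up over the 15 pairs of disjoint edges: every winding number occurs twice, whereas the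
  -- signs contribute one for each of the five crossings of the diagonals of a convex pentagon.
  have e1 := key 0 1 2 3 (by decide) (by decide) (by decide) (by decide) (by decide) (by decide)
  have e2 := key 0 1 2 4 (by decide) (by decide) (by decide) (by decide) (by decide) (by decide)
  have e3 := key 0 1 3 4 (by decide) (by decide) (by decide) (by decide) (by decide) (by decide)
  have e4 := key 0 2 1 3 (by decide) (by decide) (by decide) (by decide) (by decide) (by decide)
  have e5 := key 0 2 1 4 (by decide) (by decide) (by decide) (by decide) (by decide) (by decide)
  have e6 := key 0 2 3 4 (by decide) (by decide) (by decide) (by decide) (by decide) (by decide)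
  have e7 := key 0 3 1 2 (by decide) (by decide) (by decide) (by decide) (by decide) (by decide)
  have e8 := key 0 3 1 4 (by decide) (by decide) (by decide) (by decide) (by decide) (by decide)
  have e9 := key 0 3 2 4 (by decide) (by decide) (by decide) (by decide) (by decide) (by decide)
  have e10 := key 0 4 1 2 (by decide) (by decide) (by decide) (by decide) (by decide) (by decide)
  have e11 := key 0 4 1 3 (by decide) (by decide) (by decide) (by decide) (by decide) (by decide)
  have e12 := key 0 4 2 3 (by decide) (by decide) (by decide) (by decide) (by decide) (by decide)
  have e13 := key 1 2 3 4 (by decide) (by decide) (by decide) (by decide) (by decide) (by decide)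
  have e14 := key 1 3 2 4 (by decide) (by decide) (by decide) (by decide) (by decide) (by decide)
  have e15 := key 1 4 2 3 (by decide) (by decide) (by decide) (by decide) (by decide) (by decide)
  simp only [ε, show ∀ i j : Fin 5, (i < j) = (i.val < j.val) from fun _ _ => rfl] at *
  norm_num at e1 e2 e3 e4 e5 e6 e7 e8 e9 e10 e11 e12 e13 e14 e15
  omega

open Set in
/-- Five points of the plane cannot be joined pairwise inside sets `R i j` such that `R a b` and
`R c d` are disjoint for distinct `a, b, c, d`. -/
theorem not_disjoint_regions_of_five_points (p : Fin 5 → EuclideanSpace ℝ (Fin 2))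
    (R : Fin 5 → Fin 5 → Set (EuclideanSpace ℝ (Fin 2)))
    (hR : ∀ i j, i ≠ j → JoinedIn (R i j) (p i) (p j))
    (hdisj : ∀ a b c d, a ≠ b → c ≠ d → a ≠ c → a ≠ d → b ≠ c → b ≠ d →
      Disjoint (R a b) (R c d)) : False := by
  let φ := Complex.orthonormalBasisOneI.repr.symm
  have (i j : Fin 5) : Nonempty (Path (p i) (p j)) := ⟨.segment _ _⟩
  choose! γ hγ using hR
  refine not_disjoint_curves_of_five_points (fun i => φ (p i))
    (fun i j t => φ ((γ i j).extend t)) (fun i j _ => by fun_prop) (by simp) (by simp) ?_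
  intro a b c d hab hcd hac had hbc hbd s t h
  have mem : ∀ i j, i ≠ j → ∀ t, (γ i j).extend t ∈ R i j := fun i j hij t => by
    have : (γ i j).extend t ∈ range (γ i j).extend := mem_range_self t
    rw [Path.extend_range] at this
    obtain ⟨u, hu⟩ := this
    exact hu ▸ hγ i j hij u
  exact disjoint_left.1 (hdisj a b c d hab hcd hac had hbc hbd) (mem a b hab s)
    (φ.injective h ▸ mem c d hcd t)

namespace SimpleGraph

/-! ### Planar graphs have no `K₅` minor -/

variable {V : Type*} {G : SimpleGraph V}

/-- The part of the plane covered by the drawing of the subgraph induced on `U`. -/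
def PlaneEmbedding.trace (E : G.PlaneEmbedding) (U : Set V) : Set (EuclideanSpace ℝ (Fin 2)) :=
  {x | (∃ v ∈ U, x = E.point v) ∨ ∃ e ∈ G.edgeSet, (∀ v ∈ e, v ∈ U) ∧ x ∈ E.arc e}

theorem PlaneEmbedding.trace_mono (E : G.PlaneEmbedding) {U W : Set V} (h : U ⊆ W) :
    E.trace U ⊆ E.trace W := by
  rintro x (⟨v, hv, hx⟩ | ⟨e, he, heU, hx⟩)
  · exact Or.inl ⟨v, h hv, hx⟩
  · exact Or.inr ⟨e, he, fun v hv => h (heU v hv), hx⟩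

theorem PlaneEmbedding.disjoint_trace (E : G.PlaneEmbedding) {U W : Set V} (h : Disjoint U W) :
    Disjoint (E.trace U) (E.trace W) := by
  rw [Set.disjoint_left] at h ⊢
  rintro x (⟨v, hv, rfl⟩ | ⟨e, he, heU, hx⟩) (⟨w, hw, hxw⟩ | ⟨f, hf, hfW, hxf⟩)
  · exact h hv (E.point_injective hxw ▸ hw)
  · exact h hv (hfW v (E.point_mem_arc f hf v hxf))
  · subst hxw
    exact h (heU w (E.point_mem_arc e he w hx)) hw
  · have hef : e ≠ f := by
      rintro rfl
      induction e with
      | _ u v => exact h (heU u (Sym2.mem_mk_left u v)) (hfW u (Sym2.mem_mk_left u v))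
    obtain ⟨w, hwe, hwf, -⟩ := E.arc_inter_arc e he f hf hef x ⟨hx, hxf⟩
    exact h (heU w hwe) (hfW w hwf)

theorem PlaneEmbedding.joinedIn_trace_of_adj (E : G.PlaneEmbedding) {U : Set V} {u v : V}
    (hu : u ∈ U) (hv : v ∈ U) (h : G.Adj u v) :
    JoinedIn (E.trace U) (E.point u) (E.point v) := by
  obtain ⟨γ, -, hγ⟩ := E.arc_isArc u v h
  refine ⟨γ, fun t => Or.inr ⟨s(u, v), h, ?_, hγ ▸ Set.mem_range_self t⟩⟩
  rintro w hw
  rcases Sym2.mem_iff.1 hw with rfl | rfl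
  exacts [hu, hv]

theorem PlaneEmbedding.joinedIn_trace_of_reachable (E : G.PlaneEmbedding) {U : Set V} {u v : U}
    (h : (G.induce U).Reachable u v) : JoinedIn (E.trace U) (E.point u) (E.point v) := by
  obtain ⟨w⟩ := h
  induction w with
  | nil => exact JoinedIn.refl (Or.inl ⟨_, Subtype.property _, rfl⟩)
  | cons h _ ih =>
    exact (E.joinedIn_trace_of_adj (Subtype.property _) (Subtype.property _) h).trans ih

/-- A planar graph has no `K₅` minor: there are no five disjoint connected branch sets any two of
which are adjacent. No contraction is needed, since a drawing of `K₅` whose edges run through the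
traces of unions of two branch sets is good enough for the parity argument. -/
theorem IsPlanar.not_five_branch_sets (hG : G.IsPlanar) (B : Fin 5 → Set V)
    (hconn : ∀ i, (G.induce (B i)).Connected) (hdisj : Pairwise fun i j => Disjoint (B i) (B j))
    (hadj : ∀ i j, i ≠ j → ∃ u ∈ B i, ∃ v ∈ B j, G.Adj u v) : False := by
  obtain ⟨E⟩ := hG
  have r : ∀ i, B i := fun i => (hconn i).nonempty.some
  refine not_disjoint_regions_of_five_points (fun i => E.point (r i))
    (fun i j => E.trace (B i ∪ B j)) ?_ ?_
  · intro i j hij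
    obtain ⟨u, hu, v, hv, huv⟩ := hadj i j hij
    have h1 := E.joinedIn_trace_of_reachable ((hconn i).preconnected (r i) ⟨u, hu⟩)
    have h2 := E.joinedIn_trace_of_reachable ((hconn j).preconnected ⟨v, hv⟩ (r j))
    exact ((h1.mono (E.trace_mono Set.subset_union_left)).trans
      (E.joinedIn_trace_of_adj (Or.inl hu) (Or.inr hv) huv)).trans
      (h2.mono (E.trace_mono Set.subset_union_right))
  · intro a b c d _ _ hac had hbc hbd
    refine E.disjoint_trace ?_
    simp only [Set.disjoint_union_left, Set.disjoint_union_right]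
    exact ⟨⟨hdisj hac, hdisj hbc⟩, hdisj had, hdisj hbd⟩

/-! ### Counting 4-cliques along separating triangles -/

/-- In a planar graph, a connected set of vertices that avoids a 4-clique is adjacent to at most
three vertices of the clique. -/
theorem IsPlanar.exists_not_adj_of_isNClique_four (hG : G.IsPlanar) {T : Finset V}
    (hT : G.IsNClique 4 T) {C : Set V} (hC : (G.induce C).Connected) (hCT : Disjoint C T) :
    ∃ t ∈ T, ∀ y ∈ C, ¬ G.Adj y t := by
  by_contra! hcon
  let e : Fin 4 ≃ T := (T.equivFinOfCardEq hT.card_eq).symm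
  have hsing : ∀ i, Disjoint C {(e i : V)} := fun i =>
    Set.disjoint_singleton_right.2 fun h => Set.disjoint_left.1 hCT h (e i).2
  refine hG.not_five_branch_sets (Fin.cons C fun i => {(e i : V)}) ?_ ?_ ?_
  · intro i
    cases i using Fin.cases with
    | zero => exact hC
    | succ i =>
      change (G.induce {(e i : V)}).Connected
      exact ⟨fun u v => by rw [Subsingleton.elim u v]⟩
  · intro i j hij
    cases i using Fin.cases with
    | zero =>
      cases j using Fin.cases with
      | zero => exact absurd rfl hij
      | succ j => exact hsing j
    | succ i =>
      cases j using Fin.cases with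
      | zero => exact (hsing i).symm
      | succ j =>
        refine Set.disjoint_singleton.2 fun h => hij ?_
        exact congrArg Fin.succ (e.injective (Subtype.ext h))
  · intro i j hij
    cases i using Fin.cases with
    | zero =>
      cases j using Fin.cases with
      | zero => exact absurd rfl hij
      | succ j =>
        obtain ⟨y, hy, h⟩ := hcon (e j) (e j).2
        exact ⟨y, hy, e j, rfl, h⟩
    | succ i =>
      cases j using Fin.cases with
      | zero =>
        obtain ⟨y, hy, h⟩ := hcon (e i) (e i).2
        exact ⟨e i, rfl, y, hy, h.symm⟩
      | succ j =>
        refine ⟨e i, rfl, e j, rfl, hT.isClique (e i).2 (e j).2 fun h => hij ?_⟩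
        rw [e.injective (Subtype.ext h)]

/-- A vertex of `U` lies in a connected set `C ⊆ U` that is closed under adjacency in `U`, namely
its component in the graph induced on `U`. -/
theorem exists_connected_closed_set (G : SimpleGraph V) {U : Set V} {x : V} (hx : x ∈ U) :
    ∃ C ⊆ U, x ∈ C ∧ (G.induce C).Connected ∧ ∀ y ∈ C, ∀ z ∈ U, G.Adj y z → z ∈ C := by
  let c := (G.induce U).connectedComponentMk ⟨x, hx⟩
  refine ⟨(↑) '' c.supp, by simp, ⟨⟨x, hx⟩, rfl, rfl⟩, ?_, ?_⟩
  · have h := c.connected_toSimpleGraph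
    refine h.map ⟨fun v => ⟨v.1.1, v.1, v.2, rfl⟩, fun {a b} h => h⟩ ?_
    rintro ⟨_, v, hv, rfl⟩
    exact ⟨⟨v, hv⟩, rfl⟩
  · rintro _ ⟨y, hy, rfl⟩ z hz hyz
    refine ⟨⟨z, hz⟩, ?_, rfl⟩
    have : (G.induce U).Adj y ⟨z, hz⟩ := hyz
    exact (ConnectedComponent.mem_supp_congr_adj c this).1 hy

open Classical in
/-- The induction is on `S`. A component `C` of `S \ T`, for a 4-clique `T`, is not adjacent to
some `t ∈ T`, so that every 4-clique lies in one of the smaller sets `C ∪ (T \ {t})` and `S \ C`,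
whose cardinalities add up to `S.card + 3`. -/
theorem IsPlanar.card_cliques_four_le (hG : G.IsPlanar) (S : Finset V) (hS : 3 ≤ S.card) :
    (S.powerset.filter fun Q => G.IsNClique 4 Q).card ≤ S.card - 3 := by
  induction S using Finset.strongInduction with
  | H S ih =>
  rcases (S.powerset.filter fun Q => G.IsNClique 4 Q).eq_empty_or_nonempty with h | ⟨T, hT⟩
  · simp [h]
  obtain ⟨hTS, hT4⟩ : T ⊆ S ∧ G.IsNClique 4 T := by simpa using hT
  rcases hTS.eq_or_ssubset with rfl | hss
  · have : (T.powerset.filter fun Q => G.IsNClique 4 Q) ⊆ {T} := by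
      intro Q hQ
      obtain ⟨hQT, hQ4⟩ : Q ⊆ T ∧ G.IsNClique 4 Q := by simpa using hQ
      rw [Finset.mem_singleton]
      exact Finset.eq_of_subset_of_card_le hQT (by rw [hQ4.card_eq, hT4.card_eq])
    have := Finset.card_le_card this
    rw [Finset.card_singleton] at this
    rw [hT4.card_eq]
    exact this
  obtain ⟨x, hxS, hxT⟩ := Finset.exists_of_ssubset hss
  obtain ⟨C', hCU, hxC, hconn, hclosed⟩ :=
    G.exists_connected_closed_set (U := {y | y ∈ S ∧ y ∉ T}) ⟨hxS, hxT⟩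
  obtain ⟨t, htT, ht⟩ := hG.exists_not_adj_of_isNClique_four hT4 hconn
    (Set.disjoint_left.2 fun y hy => (hCU hy).2)
  let C := S.filter (· ∈ C')
  have memC : ∀ y, y ∈ C ↔ y ∈ C' := fun y => by
    simp only [C, Finset.mem_filter, and_iff_right_iff_imp]
    exact fun hy => (hCU hy).1
  have hCS : C ⊆ S := Finset.filter_subset _ _
  have hCT : Disjoint C (T.erase t) := Finset.disjoint_left.2 fun y hy hyT =>
    (hCU ((memC y).1 hy)).2 (Finset.mem_of_mem_erase hyT)
  have hTC : T ⊆ S \ C := fun y hy =>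
    Finset.mem_sdiff.2 ⟨hTS hy, fun h => (hCU ((memC y).1 h)).2 hy⟩
  have hsplit : (S.powerset.filter fun Q => G.IsNClique 4 Q) ⊆
      ((C ∪ T.erase t).powerset.filter fun Q => G.IsNClique 4 Q) ∪
        ((S \ C).powerset.filter fun Q => G.IsNClique 4 Q) := by
    intro Q hQ
    obtain ⟨hQS, hQ4⟩ : Q ⊆ S ∧ G.IsNClique 4 Q := by simpa using hQ
    simp only [Finset.mem_union, Finset.mem_filter, Finset.mem_powerset]
    by_cases h : ∃ y ∈ Q, y ∈ C
    · obtain ⟨y, hyQ, hyC⟩ := h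
      refine Or.inl ⟨fun z hz => ?_, hQ4⟩
      rw [Finset.mem_union]
      rcases eq_or_ne y z with rfl | hyz
      · exact Or.inl hyC
      have hadj : G.Adj y z := hQ4.isClique hyQ hz hyz
      by_cases hzT : z ∈ T
      · refine Or.inr (Finset.mem_erase.2 ⟨?_, hzT⟩)
        rintro rfl
        exact ht y ((memC y).1 hyC) hadj
      · exact Or.inl ((memC z).2 (hclosed y ((memC y).1 hyC) z ⟨hQS hz, hzT⟩ hadj))
    · push Not at h
      exact Or.inr ⟨fun z hz => Finset.mem_sdiff.2 ⟨hQS hz, h z hz⟩, hQ4⟩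
  have hA : (C ∪ T.erase t).card = C.card + 3 := by
    rw [Finset.card_union_of_disjoint hCT, Finset.card_erase_of_mem htT, hT4.card_eq]
  have hB : (S \ C).card = S.card - C.card := Finset.card_sdiff_of_subset hCS
  have hB4 : 4 ≤ (S \ C).card := hT4.card_eq ▸ Finset.card_le_card hTC
  have hAS : C ∪ T.erase t ⊂ S := by
    refine Finset.ssubset_iff_of_subset
      (Finset.union_subset hCS ((Finset.erase_subset _ _).trans hTS)) |>.2 ⟨t, hTS htT, ?_⟩
    simp only [Finset.mem_union, Finset.mem_erase, ne_eq, not_true_eq_false, false_and, or_false]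
    exact (Finset.mem_sdiff.1 (hTC htT)).2
  have hBS : S \ C ⊂ S := Finset.sdiff_ssubset hCS ⟨x, (memC x).2 hxC⟩
  have h1 := ih _ hAS (by omega)
  have h2 := ih _ hBS (by omega)
  have h3 := (Finset.card_le_card hsplit).trans (Finset.card_union_le _ _)
  omega

theorem IsPlanar.numCliques_four_le [Fintype V] (hG : G.IsPlanar) (h3 : 3 ≤ Fintype.card V) :
    G.numCliques 4 ≤ Fintype.card V - 3 := by
  classical
  have h := hG.card_cliques_four_le Finset.univ h3
  rw [numCliques, ← Finset.card_univ]
  convert h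
  rw [← Set.ncard_coe_finset]
  simp

/-! ### A straight-line drawing of the join of an edge and a path -/

/-- The join of the edge `{0, 1}` with the path `2, 3, …, n - 1`, a stacked triangulation. -/
def edgeJoinPath (n : ℕ) : SimpleGraph (Fin n) where
  Adj u v := u ≠ v ∧ (u.val ≤ 1 ∨ v.val ≤ 1 ∨ u.val + 1 = v.val ∨ v.val + 1 = u.val)
  symm := ⟨fun u v h => ⟨h.1.symm, by tauto⟩⟩
  loopless := ⟨fun u h => h.1 rfl⟩

/-- The vertices `0` and `1` are placed at `(0, 1)` and `(0, -1)`, the vertex `i` of the path at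
`(i - 1, 0)`. -/
noncomputable def edgeJoinPathPoint {n : ℕ} (i : Fin n) : EuclideanSpace ℝ (Fin 2) :=
  if i.val = 0 then !₂[0, 1] else if i.val = 1 then !₂[0, -1] else !₂[(i.val : ℝ) - 1, 0]

theorem eq_edgeJoinPathPoint_iff {n : ℕ} {x : EuclideanSpace ℝ (Fin 2)} {i : Fin n} :
    x = edgeJoinPathPoint i ↔ (i.val = 0 ∧ x 0 = 0 ∧ x 1 = 1) ∨ (i.val = 1 ∧ x 0 = 0 ∧ x 1 = -1) ∨
      (2 ≤ i.val ∧ x 0 = i.val - 1 ∧ x 1 = 0) := by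
  have key : ∀ y : EuclideanSpace ℝ (Fin 2), x = y ↔ x 0 = y 0 ∧ x 1 = y 1 := fun y => by
    refine ⟨by rintro rfl; simp, fun h => ?_⟩
    ext k
    fin_cases k
    exacts [h.1, h.2]
  rw [key, edgeJoinPathPoint]
  split_ifs with h0 h1
  · simp [h0]
  · simp [h1]
  · have : 2 ≤ i.val := by omega
    simp [h0, h1, this]

theorem edgeJoinPathPoint_injective (n : ℕ) :
    Function.Injective (edgeJoinPathPoint : Fin n → EuclideanSpace ℝ (Fin 2)) := by
  intro i j h
  have hi := eq_edgeJoinPathPoint_iff.1 (rfl : edgeJoinPathPoint i = edgeJoinPathPoint i)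
  have hj := eq_edgeJoinPathPoint_iff.1 h
  have cast_inj : (i.val : ℝ) = j.val → i.val = j.val := fun h => by exact_mod_cast h
  apply Fin.ext
  rcases hi with ⟨hi, a, b⟩ | ⟨hi, a, b⟩ | ⟨hi, a, b⟩ <;>
    rcases hj with ⟨hj, c, d⟩ | ⟨hj, c, d⟩ | ⟨hj, c, d⟩ <;>
    first
    | omega
    | (exfalso; linarith)
    | (apply cast_inj; linarith)

/-- Coordinates on the segments that represent the edges of `edgeJoinPath n`. -/
theorem coord_of_mem_segment_edgeJoinPathPoint {n : ℕ} {u v : Fin n} (huv : u < v)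
    (h : (edgeJoinPath n).Adj u v) {x : EuclideanSpace ℝ (Fin 2)}
    (hx : x ∈ segment ℝ (edgeJoinPathPoint u) (edgeJoinPathPoint v)) :
    (u.val = 0 ∧ v.val = 1 ∧ x 0 = 0) ∨
    (u.val = 0 ∧ 2 ≤ v.val ∧ x 0 = (v.val - 1) * (1 - x 1) ∧ 0 ≤ x 1) ∨
    (u.val = 1 ∧ 2 ≤ v.val ∧ x 0 = (v.val - 1) * (1 + x 1) ∧ x 1 ≤ 0) ∨
    (2 ≤ u.val ∧ v.val = u.val + 1 ∧ x 1 = 0 ∧ (u.val : ℝ) - 1 ≤ x 0 ∧ x 0 ≤ u.val) := by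
  obtain ⟨a, b, ha, hb, hab, rfl⟩ := hx
  have hlt : u.val < v.val := huv
  obtain rfl : a = 1 - b := by linarith
  have hu := eq_edgeJoinPathPoint_iff.1 (rfl : edgeJoinPathPoint u = edgeJoinPathPoint u)
  have hv := eq_edgeJoinPathPoint_iff.1 (rfl : edgeJoinPathPoint v = edgeJoinPathPoint v)
  simp only [PiLp.add_apply, PiLp.smul_apply, smul_eq_mul]
  rcases hu with ⟨hu, c, d⟩ | ⟨hu, c, d⟩ | ⟨hu, c, d⟩ <;>
    rcases hv with ⟨hv, e, f⟩ | ⟨hv, e, f⟩ | ⟨hv, e, f⟩ <;> rw [c, d, e, f]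
  · omega
  · exact Or.inl ⟨hu, hv, by ring⟩
  · exact Or.inr (Or.inl ⟨hu, hv, by ring, by linarith⟩)
  · omega
  · omega
  · exact Or.inr (Or.inr (Or.inl ⟨hu, hv, by ring, by linarith⟩))
  · omega
  · omega
  · have hs : v.val = u.val + 1 := by
      rcases h.2 with h | h | h | h <;> omega
    refine Or.inr (Or.inr (Or.inr ⟨hu, hs, by ring, ?_, ?_⟩)) <;> rw [hs] <;> push_cast <;> linarith

theorem mem_of_edgeJoinPathPoint_mem_segment {n : ℕ} {u v : Fin n} (huv : u < v)
    (h : (edgeJoinPath n).Adj u v) {w : Fin n}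
    (hw : edgeJoinPathPoint w ∈ segment ℝ (edgeJoinPathPoint u) (edgeJoinPathPoint v)) :
    w = u ∨ w = v := by
  have hlt : u.val < v.val := huv
  have hc := coord_of_mem_segment_edgeJoinPathPoint huv h hw
  have hp := eq_edgeJoinPathPoint_iff.1 (rfl : edgeJoinPathPoint w = edgeJoinPathPoint w)
  rw [Fin.ext_iff, Fin.ext_iff]
  have hcast : ∀ k : ℕ, 2 ≤ k → (2 : ℝ) ≤ k := fun k hk => by exact_mod_cast hk
  rcases hp with ⟨hp, a, b⟩ | ⟨hp, a, b⟩ | ⟨hp, a, b⟩ <;>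
    rcases hc with ⟨hu, hv, c⟩ | ⟨hu, hv, c, d⟩ | ⟨hu, hv, c, d⟩ | ⟨hu, hv, c, d, e⟩ <;>
    first
    | omega
    | (exfalso; have := hcast _ hv; rw [a, b] at *; linarith)
    | (exfalso; have := hcast _ hp; rw [a] at *; linarith)
    | (exfalso; have := hcast _ hu; rw [a, b] at *; linarith)
    | (right; rw [a, b] at c
       have : (w.val : ℝ) = v.val := by linarith
       exact_mod_cast this)
    | (rw [a] at d e
       have h1 : (u.val : ℝ) ≤ w.val := by linarith
       have h2 : (w.val : ℝ) ≤ (u.val + 1 : ℕ) := by push_cast; linarith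
       have h1' : u.val ≤ w.val := by exact_mod_cast h1
       have h2' : w.val ≤ u.val + 1 := by exact_mod_cast h2
       omega)

theorem edgeJoinPath_exists_common_end_of_mem_segment {n : ℕ} {u v u' v' : Fin n}
    (huv : u < v) (h : (edgeJoinPath n).Adj u v) (huv' : u' < v') (h' : (edgeJoinPath n).Adj u' v')
    (hne : ¬ (u = u' ∧ v = v')) {x : EuclideanSpace ℝ (Fin 2)}
    (hx : x ∈ segment ℝ (edgeJoinPathPoint u) (edgeJoinPathPoint v))
    (hx' : x ∈ segment ℝ (edgeJoinPathPoint u') (edgeJoinPathPoint v')) :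
    ∃ w, (w = u ∨ w = v) ∧ (w = u' ∨ w = v') ∧ x = edgeJoinPathPoint w := by
  have hc := coord_of_mem_segment_edgeJoinPathPoint huv h hx
  have hc' := coord_of_mem_segment_edgeJoinPathPoint huv' h' hx'
  simp only [Fin.ext_iff] at hne
  simp only [eq_edgeJoinPathPoint_iff, Fin.ext_iff]
  have hcast : ∀ k : Fin n, 2 ≤ k.val → (2 : ℝ) ≤ k.val := fun k hk => by exact_mod_cast hk
  have hle : ∀ i j : ℕ, (i : ℝ) ≤ j → i ≤ j := fun i j h => by exact_mod_cast h
  -- A spoke has `x 0 = (m - 1) * y` with `y = 1 ∓ x 1`, and `y = 0` holds at its apex only. Hence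
  -- it meets the edge `{0, 1}` and the other spokes from the same apex in that apex only.
  have spoke : ∀ (m : ℕ) (y : ℝ), 2 ≤ m → (0 : ℝ) = (m - 1) * y → y = 0 := fun m y hm h => by
    have : (2 : ℝ) ≤ m := by exact_mod_cast hm
    exact (mul_eq_zero.1 h.symm).resolve_left (by linarith)
  have spokes : ∀ (m k : ℕ) (y : ℝ), m ≠ k → ((m : ℝ) - 1) * y = (k - 1) * y → y = 0 :=
    fun m k y hm h => by
      have : ((m : ℝ) - k) * y = 0 := by linear_combination h
      exact (mul_eq_zero.1 this).resolve_left (sub_ne_zero.2 (by exact_mod_cast hm))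
  rcases hc with ⟨hu, hv, c⟩ | ⟨hu, hv, c, d⟩ | ⟨hu, hv, c, d⟩ | ⟨hu, hv, c, d, e⟩ <;>
    rcases hc' with ⟨hu', hv', c'⟩ | ⟨hu', hv', c', d'⟩ | ⟨hu', hv', c', d'⟩ |
      ⟨hu', hv', c', d', e'⟩
  · omega
  · have := spoke _ _ hv' (c.symm.trans c')
    exact ⟨u, by simp, by omega, Or.inl ⟨hu, c, by linarith⟩⟩
  · have := spoke _ _ hv' (c.symm.trans c')
    exact ⟨v, by simp, by omega, Or.inr (Or.inl ⟨hv, c, by linarith⟩)⟩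
  · have := hcast _ hu'
    linarith
  · have := spoke _ _ hv (c'.symm.trans c)
    exact ⟨u, by simp, by omega, Or.inl ⟨hu, c', by linarith⟩⟩
  · have := spokes _ _ _ (by omega) (c.symm.trans c')
    exact ⟨u, by simp, by omega, Or.inl ⟨hu, by rw [c, this, mul_zero], by linarith⟩⟩
  · have h1 : x 1 = 0 := by linarith
    rw [h1] at c c'
    have := hle v v' (by linarith)
    have := hle v' v (by linarith)
    exact ⟨v, by simp, by omega, Or.inr (Or.inr ⟨hv, by linarith, h1⟩)⟩
  · rw [c'] at c
    have := hle u' v (by linarith)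
    have := hle v v' (by rw [hv']; push_cast; linarith)
    exact ⟨v, by simp, by omega, Or.inr (Or.inr ⟨hv, by linarith, c'⟩)⟩
  · have := spoke _ _ hv (c'.symm.trans c)
    exact ⟨u, by simp, by omega, Or.inr (Or.inl ⟨hu, c', by linarith⟩)⟩
  · have h1 : x 1 = 0 := by linarith
    rw [h1] at c c'
    have := hle v v' (by linarith)
    have := hle v' v (by linarith)
    exact ⟨v, by simp, by omega, Or.inr (Or.inr ⟨hv, by linarith, h1⟩)⟩
  · have := spokes _ _ _ (by omega) (c.symm.trans c')
    exact ⟨u, by simp, by omega, Or.inr (Or.inl ⟨hu, by rw [c, this, mul_zero], by linarith⟩)⟩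
  · rw [c'] at c
    have := hle u' v (by linarith)
    have := hle v v' (by rw [hv']; push_cast; linarith)
    exact ⟨v, by simp, by omega, Or.inr (Or.inr ⟨hv, by linarith, c'⟩)⟩
  · have := hcast _ hu
    linarith
  · rw [c] at c'
    have := hle u v' (by linarith)
    have := hle v' v (by rw [hv]; push_cast; linarith)
    exact ⟨v', by omega, by simp, Or.inr (Or.inr ⟨hv', by linarith, c⟩)⟩
  · rw [c] at c'
    have := hle u v' (by linarith)
    have := hle v' v (by rw [hv]; push_cast; linarith)
    exact ⟨v', by omega, by simp, Or.inr (Or.inr ⟨hv', by linarith, c⟩)⟩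
  · have h1 := hle u (u' + 1) (by push_cast; linarith)
    have h2 := hle u' (u + 1) (by push_cast; linarith)
    rcases (show u'.val = u.val + 1 ∨ u.val = u'.val + 1 by omega) with h3 | h3
    · refine ⟨v, by simp, by omega, Or.inr (Or.inr ⟨by omega, ?_, c⟩)⟩
      rw [h3] at d'
      rw [hv]
      push_cast at d' ⊢
      linarith
    · refine ⟨v', by omega, by simp, Or.inr (Or.inr ⟨by omega, ?_, c⟩)⟩
      rw [h3] at d
      rw [hv']
      push_cast at d ⊢
      linarith

theorem exists_lt_of_mem_edgeSet {α : Type*} [LinearOrder α] {G : SimpleGraph α} {e : Sym2 α}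
    (he : e ∈ G.edgeSet) : ∃ u v, u < v ∧ G.Adj u v ∧ e = s(u, v) := by
  induction e with
  | _ u v =>
    rcases lt_or_gt_of_ne (G.ne_of_adj he) with h | h
    · exact ⟨u, v, h, he, rfl⟩
    · exact ⟨v, u, h, he.symm, Sym2.eq_swap⟩

theorem isPlanar_edgeJoinPath (n : ℕ) : (edgeJoinPath n).IsPlanar :=
  ⟨{ point := edgeJoinPathPoint
     arc := Sym2.lift ⟨fun u v => segment ℝ (edgeJoinPathPoint u) (edgeJoinPathPoint v),
       fun _ _ => segment_symm ℝ _ _⟩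
     point_injective := edgeJoinPathPoint_injective n
     arc_isArc := fun u v h => ⟨.segment _ _, Path.segment_injective_of_ne
       ((edgeJoinPathPoint_injective n).ne h.1), Path.range_segment _ _⟩
     point_mem_arc := by
       intro e he w hw
       obtain ⟨u, v, huv, h, rfl⟩ := exists_lt_of_mem_edgeSet he
       exact Sym2.mem_iff.2 (mem_of_edgeJoinPathPoint_mem_segment huv h hw)
     arc_inter_arc := by
       intro e he f hf hef x hx
       obtain ⟨u, v, huv, h, rfl⟩ := exists_lt_of_mem_edgeSet he
       obtain ⟨u', v', huv', h', rfl⟩ := exists_lt_of_mem_edgeSet hf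
       simp only [Sym2.mem_iff]
       refine edgeJoinPath_exists_common_end_of_mem_segment huv h huv' h' ?_ hx.1 hx.2
       rintro ⟨rfl, rfl⟩
       exact hef rfl }⟩

/-- The `n - 3` sets `{0, 1, i, i + 1}` with `2 ≤ i` are 4-cliques of every supergraph of
`edgeJoinPath n`. -/
theorem le_numCliques_four_of_edgeJoinPath_le {n : ℕ} {G : SimpleGraph (Fin n)}
    (hG : edgeJoinPath n ≤ G) : n - 3 ≤ G.numCliques 4 := by
  have hlt : ∀ i : Fin (n - 3), i.val + 3 < n := fun i => by omega
  let Q : Fin (n - 3) → Finset (Fin n) := fun i =>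
    {⟨0, by have := hlt i; omega⟩, ⟨1, by have := hlt i; omega⟩, ⟨i + 2, by have := hlt i; omega⟩,
      ⟨i + 3, hlt i⟩}
  have hQ : ∀ i, G.IsNClique 4 (Q i) := fun i => by
    refine IsNClique.mono hG ⟨?_, ?_⟩
    · intro u hu v hv huv
      refine ⟨huv, ?_⟩
      simp only [Q, Finset.coe_insert, Finset.coe_singleton, Set.mem_insert_iff,
        Set.mem_singleton_iff, Fin.ext_iff] at hu hv
      have := Fin.val_ne_of_ne huv
      omega
    · simp [Q, Fin.ext_iff]
  have hinj : Function.Injective Q := fun i j h => by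
    have h1 : (⟨i + 2, by omega⟩ : Fin n) ∈ Q j := h ▸ by simp [Q]
    have h2 : (⟨j + 2, by omega⟩ : Fin n) ∈ Q i := h ▸ by simp [Q]
    simp only [Q, Finset.mem_insert, Finset.mem_singleton, Fin.ext_iff] at h1 h2
    apply Fin.ext
    omega
  calc n - 3 = (Set.range Q).ncard := by
        rw [← Set.image_univ, Set.ncard_image_of_injective _ hinj, Set.ncard_univ, Nat.card_fin]
    _ ≤ G.numCliques 4 := Set.ncard_le_ncard (by rintro _ ⟨i, rfl⟩; exact hQ i) (Set.toFinite _)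

end SimpleGraph

theorem theorem3 (n : ℕ) (hn : 3 ≤ n) :
    (∀ (V : Type*) [Fintype V] (G : SimpleGraph V),
      Fintype.card V = n → G.IsMaximalPlanar → G.numCliques 4 ≤ n - 3) ∧
    (∃ G : SimpleGraph (Fin n), G.IsMaximalPlanar ∧ G.numCliques 4 = n - 3) := by
  refine ⟨fun V _ G hV hG => hV ▸ hG.prop.numCliques_four_le (hV ▸ hn), ?_⟩
  obtain ⟨G, hle, hG⟩ := Set.Finite.exists_le_maximal
    (Set.toFinite {H : SimpleGraph (Fin n) | H.IsPlanar}) (SimpleGraph.isPlanar_edgeJoinPath n)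
  have hup := hG.prop.numCliques_four_le (by simpa using hn)
  rw [Fintype.card_fin] at hup
  exact ⟨G, hG, hup.antisymm (SimpleGraph.le_numCliques_four_of_edgeJoinPath_le hle)⟩
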